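/- Let $q$ be a prime power, let $n\ge 1$ with $\gcd(n,q)=1$, let $r\mid q-1$, and write $nr=(q^m-1)/s$ with positive integers $m>1$ and $s$. Represent residues modulo $nr$ by $\{1,2,\dots,nr\}$, let $Z_{n,r}=\{1+ir:0\le i\le n-1\}$, and for $i\in Z_{n,r}$ let $l_i$ be the size of its $q$-cyclotomic coset $C_i=\{iq^k \bmod nr: k\ge 0\}$, whose smallest element is called its leader. For $l\ge1$ let $N_l$ be the number of cosets contained in $Z_{n,r}$ that have exactly $l$ elements, and order these cosets by their leaders. Assume that $\{l_i:i\in Z_{n,r}\}=\{1,m\}$. Then $N_m=(n-\gcd(n,(q-1)/r))/m$. Let $\beta$ be a primitive $nr$-th root of unity in an extension field of $\mathbb F_q$ and let $\lambda=\beta^n\in\mathbb F_q$. For $a\le N_1$ and $b\le N_m$ let $\mathcal C(a,b)$ be the $\lambda$-constacyclic code of length $n$ over $\mathbb F_q$ generated by $\prod_{j\in T}(x-\beta^j)$, where the defining set $T$ is the union of the first $a$ cosets of size $1$ and the first $b$ cosets of size $m$ in $Z_{n,r}$. For an integer $k\ge 0$ let $S(k)$ be the set of all integer triples $(i,j,t)$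 such that $$\frac{m+1}{2}\le i\le\lfloor m-\log_q(s+1)\rfloor,\quad 1\le j\le q-1,\quad 0\le t<\frac{q^i-j(q^{m-i}-1)-1}{q^{m-i+1}-q},$$ $$q^i+qt+j\equiv 1\pmod r,\quad q^i+qt+j\le 1+\left(\left\lceil\frac{qk}{q-1}\right\rceil-2\right)r .$$ Put $S_m=S(\lceil N_m/2\rceil)$, $\Lambda_m=\left\lceil\frac{q|S_m|}{q-1}\right\rceil-1$, $S_m'=S(\lfloor N_m/2\rfloor)$ and $\Lambda_m'=\left\lceil\frac{q|S_m'|}{q-1}\right\rceil-1$. Then the minimum distance of $\mathcal C(\lceil N_1/2\rceil,\lceil N_m/2\rceil)$ is at least $$\left\lceil\frac{q\lceil N_m/2\rceil}{q-1}\right\rceil+\Lambda_m .$$ If moreover $r\le 2$, then the minimum distance of $\mathcal C(\lfloor N_1/2\rfloor,\lfloor N_m/2\rfloor)$ is at least $$\left\lceil\frac{q\lfloor N_m/2\rfloor}{q-1}\right\rceil+\Lambda_m' .$$ (The minimum distance of the zero code is taken to be $\infty$.) -/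

import Mathlib

open Polynomial

namespace Consta

/-- The set `Z_{n,r} = {1 + i r : 0 ≤ i ≤ n - 1}`, inside `{1, 2, …, n r}`. -/
def Z (n r : ℕ) : Finset ℕ := (Finset.range n).image fun i => 1 + i * r

open Classical in
/-- The `q`-cyclotomic coset of `i` modulo `N`, with representatives in `{1, 2, …, N}`. -/
noncomputable def coset (q N i : ℕ) : Finset ℕ :=
  (Finset.Icc 1 N).filter fun x => ∃ k : ℕ, x ≡ i * q ^ k [MOD N]

open Classical in
/-- The coset leaders (smallest elements of their cosets) lying in `Z_{n,r}` of the
`q`-cyclotomic cosets modulo `n r` that have exactly `l` elements. -/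
noncomputable def leaders (q n r l : ℕ) : Finset ℕ :=
  (Z n r).filter fun i => (∀ x ∈ coset q (n * r) i, i ≤ x) ∧ (coset q (n * r) i).card = l

/-- `N_l`: the number of cosets in `Z_{n,r}` with exactly `l` elements. -/
noncomputable def numCosets (q n r l : ℕ) : ℕ := (leaders q n r l).card

/-- The `k` smallest elements of `s` (all of `s` if it has at most `k` elements). -/
def firstElems (s : Finset ℕ) (k : ℕ) : Finset ℕ :=
  s.filter fun x => (s.filter fun y => y < x).card < k

/-- The product of the minimal polynomials over `F` of the `β ^ i`, for `i` among the first `a`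
leaders of cosets of size `l` and the first `b` leaders of cosets of size `m` in `Z_{n,r}`
(for `l ≠ m`).  If `|F| = q` and `β` is a primitive `n r`-th root of unity, its roots are
the `β ^ j` with `j` in the union of these `a + b` cosets. -/
noncomputable def genPoly (F : Type*) {K : Type*} [Field F] [Field K] [Algebra F K] (β : K)
    (q n r l m a b : ℕ) : F[X] :=
  (∏ i ∈ firstElems (leaders q n r l) a, minpoly F (β ^ i)) *
    ∏ i ∈ firstElems (leaders q n r m) b, minpoly F (β ^ i)

/-- The `lam`-constacyclic code `⟨g⟩` of length `n`: the words `(c_0, …, c_{n-1})` for which the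
class of `c_0 + c_1 x + … + c_{n-1} x^{n-1}` lies in the ideal of `F[x] / (x^n - lam)`
generated by the class of `g`. -/
noncomputable def constacyclicCode {F : Type*} [Field F] (n : ℕ) (lam : F) (g : F[X]) :
    Submodule F (Fin n → F) :=
  ((Ideal.span {AdjoinRoot.mk (X ^ n - C lam) g}).restrictScalars F).comap
    (Fintype.linearCombination F fun k : Fin n => AdjoinRoot.root (X ^ n - C lam) ^ (k : ℕ))

open Classical in
/-- The minimum distance of a code, the least Hamming distance of two distinct codewords
(`⊤` for the zero code). -/
noncomputable def minDist {F : Type*} [Field F] {n : ℕ} (C : Submodule F (Fin n → F)) : ℕ∞ :=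
  ⨅ x ∈ C, ⨅ y ∈ C, ⨅ _ : x ≠ y, (hammingDist x y : ℕ∞)

/-- `⌈q k / (q - 1)⌉`. -/
def ceilFrac (q k : ℕ) : ℤ := ⌈((q : ℚ) * k) / ((q : ℚ) - 1)⌉

/-- The set of triples `(i, j, t)` called `S_m` (with `k = ⌈N_m / 2⌉`) or `S_m'`
(with `k = ⌊N_m / 2⌋`).  The second condition forces `i ≤ m`. -/
def tripleSet (q r s m k : ℕ) : Set (ℕ × ℕ × ℕ) :=
  {p | match p with
    | (i, j, t) =>
      ((m : ℝ) + 1) / 2 ≤ i ∧ (i : ℤ) ≤ ⌊(m : ℝ) - Real.logb q ((s : ℝ) + 1)⌋ ∧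
      1 ≤ j ∧ j ≤ q - 1 ∧
      (t : ℝ) < ((q : ℝ) ^ i - j * ((q : ℝ) ^ (m - i) - 1) - 1) /
        ((q : ℝ) ^ (m - i + 1) - q) ∧
      q ^ i + q * t + j ≡ 1 [MOD r] ∧
      ((q ^ i + q * t + j : ℕ) : ℤ) ≤ 1 + (ceilFrac q k - 2) * r}

/-- The lower bound `⌈q k / (q - 1)⌉ + Λ`, where `Λ = ⌈q |S| / (q - 1)⌉ - 1` and `S` is the
set of triples belonging to `k`. -/
noncomputable def distBound (q r s m k : ℕ) : ℤ :=
  ceilFrac q k + (ceilFrac q (tripleSet q r s m k).ncard - 1)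

end Consta

namespace Consta

/-! ### Cyclotomic cosets in `Z` and the count of singleton cosets -/

section Cosets

variable {q n r m N : ℕ}

/-! By the BCH bound (`le_minDist_of_aeval_eq_zero`) it suffices that `1 + e * r` lies in the
defining set for every `e ≤ δ - 2`, with `δ` the claimed bound. The leader of the coset of such an
element has index at most `e`, so the question is whether few enough leaders of the same coset size
precede it.

Size `m`: a leader is never a multiple of `q`, since dividing by `q` gives a smaller element of its
coset. A triple gives `x = q^i + y` with `y = q * t + j`; multiplying by `q^(m-i)` moves it to `1 +
y * q^(m-i)`, and the bound on `t` says exactly that this is smaller than `x`. So triples are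
further non-leaders, prime to the first kind because `q ∤ j`. Discarding both kinds from the first
`δ - 1` indices leaves at most `k` (`card_add_ncard_tripleSet_le`, `sub_div_le`,
`mem_firstElems_leaders`).

Size `1`: these elements are the multiples of `d = n / gcd(n, (q-1)/r)`, one in every `d`
consecutive indices. The indices up to `δ - 2` lie in the first half of `Z`
(`two_mul_distBound_lt`), where about half of the singletons are found. Counting them exactly also
gives `N_1`, and `N_1 + m * N_m = n` then gives `N_m`. -/

theorem mem_Z {x : ℕ} : x ∈ Z n r ↔ ∃ e < n, 1 + e * r = x := by
  simp [Z]

theorem mem_coset {x y : ℕ} :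
    y ∈ coset q N x ↔ (1 ≤ y ∧ y ≤ N) ∧ ∃ k : ℕ, y ≡ x * q ^ k [MOD N] := by
  simp [coset]

theorem bounds_of_mem_Z {x : ℕ} (hr : 0 < r) (hx : x ∈ Z n r) : 1 ≤ x ∧ x ≤ n * r := by
  obtain ⟨e, he, rfl⟩ := mem_Z.1 hx
  refine ⟨by omega, ?_⟩
  calc 1 + e * r ≤ (e + 1) * r := by linarith [Nat.succ_le_of_lt hr]
    _ ≤ n * r := Nat.mul_le_mul_right _ he

theorem mem_Z_of_modEq {x : ℕ} (h1 : 1 ≤ x) (h2 : x ≤ n * r)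
    (h : x ≡ 1 [MOD r]) : x ∈ Z n r := by
  obtain ⟨e, he⟩ := (Nat.modEq_iff_dvd' h1).1 h.symm
  have hx : x = 1 + e * r := by rw [mul_comm]; omega
  refine mem_Z.2 ⟨e, ?_, hx.symm⟩
  by_contra hc
  have : n * r ≤ e * r := Nat.mul_le_mul_right _ (not_lt.1 hc)
  omega

theorem modEq_one_of_mem_Z {x : ℕ} (hx : x ∈ Z n r) : x ≡ 1 [MOD r] := by
  obtain ⟨e, -, rfl⟩ := mem_Z.1 hx
  simp [Nat.ModEq]

theorem exists_mem_Icc_modEq (hN : 0 < N) (a : ℕ) : ∃ y, 1 ≤ y ∧ y ≤ N ∧ y ≡ a [MOD N] := by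
  by_cases h : a % N = 0
  · exact ⟨N, hN, le_rfl, by simp [Nat.ModEq, h]⟩
  · exact ⟨a % N, by omega, (Nat.mod_lt _ hN).le, Nat.mod_modEq _ _⟩

theorem eq_of_modEq_Icc {x y : ℕ} (hx : 1 ≤ x) (hx' : x ≤ N) (hy : 1 ≤ y) (hy' : y ≤ N)
    (h : x ≡ y [MOD N]) : x = y := by
  have := (Nat.modEq_iff_dvd.1 h)
  obtain ⟨c, hc⟩ := this
  have h1 : c < 1 := by by_contra hh; nlinarith
  have h2 : -1 < c := by by_contra hh; nlinarith
  have : c = 0 := by omega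
  subst this
  omega

theorem mem_coset_self {x : ℕ} (h1 : 1 ≤ x) (h2 : x ≤ N) : x ∈ coset q N x :=
  mem_coset.2 ⟨⟨h1, h2⟩, 0, by simp [Nat.ModEq]⟩

theorem modEq_mul_pow_symm {x y k : ℕ} (hm : 1 ≤ m) (hq : q ^ m ≡ 1 [MOD N])
    (h : y ≡ x * q ^ k [MOD N]) : x ≡ y * q ^ (k * (m - 1)) [MOD N] := by
  have h1 : y * q ^ (k * (m - 1)) ≡ x * q ^ k * q ^ (k * (m - 1)) [MOD N] := h.mul_right _
  have h2 : x * q ^ k * q ^ (k * (m - 1)) = x * (q ^ m) ^ k := by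
    obtain ⟨d, rfl⟩ := Nat.exists_eq_add_of_le hm
    rw [mul_assoc, ← pow_add, ← pow_mul]
    congr 2
    rw [Nat.add_sub_cancel_left]; ring
  rw [h2] at h1
  have h3 : x * (q ^ m) ^ k ≡ x * 1 ^ k [MOD N] := (hq.pow k).mul_left x
  simpa using (h1.trans h3).symm

theorem coset_eq_of_mem {x y : ℕ} (hm : 1 ≤ m) (hq : q ^ m ≡ 1 [MOD N])
    (h : y ∈ coset q N x) : coset q N y = coset q N x := by
  obtain ⟨-, k, hk⟩ := mem_coset.1 h
  ext z
  simp only [mem_coset]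
  refine and_congr_right fun _ => ⟨?_, ?_⟩
  · rintro ⟨j, hj⟩
    refine ⟨k + j, hj.trans ?_⟩
    rw [pow_add, ← mul_assoc]
    exact hk.mul_right _
  · rintro ⟨j, hj⟩
    refine ⟨k * (m - 1) + j, hj.trans ?_⟩
    rw [pow_add, ← mul_assoc]
    exact (modEq_mul_pow_symm hm hq hk).mul_right _

theorem coset_subset_Z {x : ℕ} (hqr : q ≡ 1 [MOD r]) (hx : x ∈ Z n r) :
    coset q (n * r) x ⊆ Z n r := by
  intro y hy
  obtain ⟨⟨h1, h2⟩, k, hk⟩ := mem_coset.1 hy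
  refine mem_Z_of_modEq h1 h2 ?_
  have : y ≡ x * q ^ k [MOD r] := hk.of_dvd (Dvd.intro_left n rfl)
  simpa using this.trans ((modEq_one_of_mem_Z hx).mul (hqr.pow k))

theorem mem_leaders {l x : ℕ} : x ∈ leaders q n r l ↔
    x ∈ Z n r ∧ (∀ y ∈ coset q (n * r) x, x ≤ y) ∧ (coset q (n * r) x).card = l := by
  simp [leaders]

theorem exists_leader {x : ℕ} (hr : 0 < r) (hqr : q ≡ 1 [MOD r]) (hm : 1 ≤ m)
    (hq : q ^ m ≡ 1 [MOD n * r]) (hx : x ∈ Z n r) :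
    ∃ y ∈ leaders q n r (coset q (n * r) x).card, y ≤ x ∧ x ∈ coset q (n * r) y := by
  have hb := bounds_of_mem_Z hr hx
  have hself := mem_coset_self (q := q) hb.1 hb.2
  set C := coset q (n * r) x with hC
  have hne : C.Nonempty := ⟨x, hself⟩
  have hy := C.min'_mem hne
  have he := coset_eq_of_mem hm hq hy
  refine ⟨C.min' hne, mem_leaders.2 ⟨coset_subset_Z hqr hx hy, ?_, ?_⟩, C.min'_le _ hself, ?_⟩
  · intro z hz
    rw [he] at hz
    exact C.min'_le _ hz
  · rw [he]
  · rw [he]; exact hself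

theorem eq_of_leaders {l l' x y z : ℕ} (hr : 0 < r) (hm : 1 ≤ m) (hq : q ^ m ≡ 1 [MOD n * r])
    (hx : x ∈ leaders q n r l) (hy : y ∈ leaders q n r l')
    (hzx : z ∈ coset q (n * r) x) (hzy : z ∈ coset q (n * r) y) : x = y := by
  obtain ⟨hx1, hx2, -⟩ := mem_leaders.1 hx
  obtain ⟨hy1, hy2, -⟩ := mem_leaders.1 hy
  have e1 := coset_eq_of_mem hm hq hzx
  have e2 := coset_eq_of_mem hm hq hzy
  have hbx := bounds_of_mem_Z hr hx1
  have hby := bounds_of_mem_Z hr hy1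
  apply le_antisymm
  · apply hx2; rw [← e1, e2]; exact mem_coset_self hby.1 hby.2
  · apply hy2; rw [← e2, e1]; exact mem_coset_self hbx.1 hbx.2

theorem card_Z (hr : 0 < r) : (Z n r).card = n := by
  rw [Z, Finset.card_image_of_injective _ (fun a b h => ?_), Finset.card_range]
  simpa [hr.ne'] using h

theorem card_coset_mem {x : ℕ}
    (hsizes : (Z n r).image (fun i => (coset q (n * r) i).card) = {1, m}) (hx : x ∈ Z n r) :
    (coset q (n * r) x).card = 1 ∨ (coset q (n * r) x).card = m := by
  have : (coset q (n * r) x).card ∈ (Z n r).image (fun i => (coset q (n * r) i).card) :=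
    Finset.mem_image_of_mem _ hx
  simpa [hsizes] using this

theorem numCosets_one_add (hr : 0 < r) (hqr : q ≡ 1 [MOD r]) (hm : 1 < m)
    (hq : q ^ m ≡ 1 [MOD n * r])
    (hsizes : (Z n r).image (fun i => (coset q (n * r) i).card) = {1, m}) :
    numCosets q n r 1 + m * numCosets q n r m = n := by
  classical
  have hdisj : Disjoint (leaders q n r 1) (leaders q n r m) := by
    rw [Finset.disjoint_left]
    intro x h1 h2
    have a1 := (mem_leaders.1 h1).2.2
    have a2 := (mem_leaders.1 h2).2.2
    omega
  have hcover : (leaders q n r 1 ∪ leaders q n r m).biUnion (coset q (n * r)) = Z n r := by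
    ext x
    simp only [Finset.mem_biUnion, Finset.mem_union]
    constructor
    · rintro ⟨y, hy, hxy⟩
      have : y ∈ Z n r := by
        rcases hy with hy | hy <;> exact (mem_leaders.1 hy).1
      exact coset_subset_Z hqr this hxy
    · intro hx
      obtain ⟨y, hy, -, hxy⟩ := exists_leader hr hqr hm.le hq hx
      rcases card_coset_mem hsizes hx with h | h <;> rw [h] at hy
      · exact ⟨y, Or.inl hy, hxy⟩
      · exact ⟨y, Or.inr hy, hxy⟩
  have hcard := card_Z (n := n) hr
  rw [← hcover, Finset.card_biUnion, Finset.sum_union hdisj,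
    Finset.sum_congr rfl (fun x hx => (mem_leaders.1 hx).2.2),
    Finset.sum_congr rfl (fun x (hx : x ∈ leaders q n r m) => (mem_leaders.1 hx).2.2)] at hcard
  · simpa [numCosets, mul_comm] using hcard
  · intro x hx y hy hxy
    rw [Function.onFun, Finset.disjoint_left]
    intro z hzx hzy
    obtain ⟨l, hl⟩ : ∃ l, x ∈ leaders q n r l := by
      rcases Finset.mem_union.1 hx with h | h <;> exact ⟨_, h⟩
    obtain ⟨l', hl'⟩ : ∃ l, y ∈ leaders q n r l := by
      rcases Finset.mem_union.1 hy with h | h <;> exact ⟨_, h⟩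
    exact hxy (eq_of_leaders hr hm.le hq hl hl' hzx hzy)

theorem card_coset_eq_one_iff {x : ℕ} (h1 : 1 ≤ x) (h2 : x ≤ N) :
    (coset q N x).card = 1 ↔ x * q ≡ x [MOD N] := by
  have hself := mem_coset_self (q := q) h1 h2
  constructor
  · intro h
    obtain ⟨a, ha⟩ := Finset.card_eq_one.1 h
    obtain ⟨y, hy1, hy2, hy⟩ := exists_mem_Icc_modEq (h1.trans h2) (x * q)
    have hmem : y ∈ coset q N x := mem_coset.2 ⟨⟨hy1, hy2⟩, 1, by simpa using hy⟩
    rw [ha, Finset.mem_singleton] at hself hmem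
    rw [hself, ← hmem] at hy ⊢
    exact hy.symm
  · intro h
    rw [Finset.card_eq_one]
    refine ⟨x, Finset.eq_singleton_iff_unique_mem.2 ⟨hself, fun y hy => ?_⟩⟩
    obtain ⟨⟨hy1, hy2⟩, k, hk⟩ := mem_coset.1 hy
    refine eq_of_modEq_Icc hy1 hy2 h1 h2 (hk.trans ?_)
    clear hk
    induction k with
    | zero => simp [Nat.ModEq]
    | succ k ih =>
      rw [pow_succ, ← mul_assoc]
      exact (ih.mul_right q).trans h

/-- With `q - 1 = r * Q` the congruence reads `n ∣ x * Q`; cancelling `gcd(n, Q)` leaves coprime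
factors. -/
theorem mul_modEq_self_iff {x : ℕ} (hq : 1 ≤ q) (hr0 : 0 < r) (hn : 0 < n) (hr : r ∣ q - 1) :
    x * q ≡ x [MOD n * r] ↔ n / Nat.gcd n ((q - 1) / r) ∣ x := by
  obtain ⟨Q, hQ⟩ := hr
  have hq' : q = 1 + r * Q := by omega
  have hdiv : (q - 1) / r = Q := by rw [hQ]; exact Nat.mul_div_cancel_left _ hr0
  rw [hdiv]
  have h1 : x * q ≡ x [MOD n * r] ↔ n * r ∣ x * Q * r := by
    rw [Nat.ModEq.comm, Nat.modEq_iff_dvd' (Nat.le_mul_of_pos_right _ hq)]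
    have : x * q - x = x * Q * r := by
      rw [hq', mul_add, mul_one, Nat.add_sub_cancel_left]; ring
    rw [this]
  rw [h1, Nat.mul_dvd_mul_iff_right hr0]
  have hg : 0 < Nat.gcd n Q := Nat.gcd_pos_of_pos_left _ hn
  have hcop : Nat.Coprime (n / Nat.gcd n Q) (Q / Nat.gcd n Q) := Nat.coprime_div_gcd_div_gcd hg
  rw [← hcop.dvd_mul_right (m := x)]
  conv_lhs => rw [← Nat.div_mul_cancel (Nat.gcd_dvd_left n Q)]
  rw [show x * Q = x * (Q / Nat.gcd n Q) * Nat.gcd n Q by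
    rw [mul_assoc, Nat.div_mul_cancel (Nat.gcd_dvd_right n Q)]]
  exact Nat.mul_dvd_mul_iff_right hg

theorem mem_leaders_one_iff {x : ℕ} (hq : 1 ≤ q) (hr0 : 0 < r) (hn : 0 < n) (hr : r ∣ q - 1) :
    x ∈ leaders q n r 1 ↔ x ∈ Z n r ∧ n / Nat.gcd n ((q - 1) / r) ∣ x := by
  rw [mem_leaders]
  refine and_congr_right fun hx => ?_
  have hb := bounds_of_mem_Z hr0 hx
  rw [← mul_modEq_self_iff hq hr0 hn hr, ← card_coset_eq_one_iff hb.1 hb.2]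
  refine ⟨fun h => h.2, fun h => ⟨fun y hy => ?_, h⟩⟩
  obtain ⟨a, ha⟩ := Finset.card_eq_one.1 h
  have hself := mem_coset_self (q := q) hb.1 hb.2
  rw [ha, Finset.mem_singleton] at hself hy
  omega

/-- Elements of an arithmetic progression that are divisible by `d`, in terms of one of them. -/
theorem dvd_one_add_mul_iff {d e₀ e : ℕ} (h₀ : d ∣ 1 + e₀ * r) :
    d ∣ 1 + e * r ↔ e ≡ e₀ [MOD d] := by
  have hcop : Nat.gcd d r = 1 := by
    -- A single solution `e₀` already forces `d` and `r` to be coprime, so `r` can be cancelled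
    -- modulo `d`.
    have h1 : Nat.gcd d r ∣ 1 + e₀ * r := (Nat.gcd_dvd_left d r).trans h₀
    have h2 : Nat.gcd d r ∣ e₀ * r := (Nat.gcd_dvd_right d r).mul_left _
    exact Nat.dvd_one.1 ((Nat.dvd_add_left h2).1 h1)
  constructor
  · intro h
    refine Nat.ModEq.cancel_right_of_coprime hcop (Nat.ModEq.add_left_cancel' 1 ?_)
    exact ((Nat.modEq_zero_iff_dvd.2 h).trans (Nat.modEq_zero_iff_dvd.2 h₀).symm)
  · intro h
    exact Nat.modEq_zero_iff_dvd.1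
      (((h.mul_right r).add_left 1).trans (Nat.modEq_zero_iff_dvd.2 h₀))

theorem card_filter_dvd {d e₀ b : ℕ} (hd : 0 < d) (h₀ : d ∣ 1 + e₀ * r) :
    ((Finset.range b).filter fun e => d ∣ 1 + e * r).card =
      b / d + if e₀ % d < b % d then 1 else 0 := by
  rw [← Nat.count_modEq_card b hd e₀, Nat.count_eq_card_filter_range]
  congr 1
  ext e
  simp [dvd_one_add_mul_iff h₀]

theorem filter_Z_eq_image {p : ℕ → Prop} [DecidablePred p] :
    (Z n r).filter p = ((Finset.range n).filter fun e => p (1 + e * r)).image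
      fun e => 1 + e * r := by
  ext x
  simp only [Z, Finset.mem_filter, Finset.mem_image]
  constructor
  · rintro ⟨⟨e, he, rfl⟩, hp⟩
    exact ⟨e, ⟨he, hp⟩, rfl⟩
  · rintro ⟨e, ⟨he, hp⟩, rfl⟩
    exact ⟨⟨e, he, rfl⟩, hp⟩

theorem card_filter_Z (hr0 : 0 < r) {p : ℕ → Prop} [DecidablePred p] :
    ((Z n r).filter p).card = ((Finset.range n).filter fun e => p (1 + e * r)).card := by
  rw [filter_Z_eq_image, Finset.card_image_of_injective]
  intro a b h
  simpa [hr0.ne'] using h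

theorem leaders_one_eq (hq : 1 ≤ q) (hr0 : 0 < r) (hn : 0 < n) (hr : r ∣ q - 1) :
    leaders q n r 1 = (Z n r).filter fun x => n / Nat.gcd n ((q - 1) / r) ∣ x := by
  ext x
  rw [mem_leaders_one_iff hq hr0 hn hr, Finset.mem_filter]

theorem numCosets_one (hq : 1 ≤ q) (hr0 : 0 < r) (hn : 0 < n) (hr : r ∣ q - 1)
    (hne : (leaders q n r 1).Nonempty) :
    numCosets q n r 1 = Nat.gcd n ((q - 1) / r) := by
  obtain ⟨x, hx⟩ := hne
  obtain ⟨hx1, hx2⟩ := (mem_leaders_one_iff hq hr0 hn hr).1 hx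
  obtain ⟨e₀, -, rfl⟩ := mem_Z.1 hx1
  have hg : 0 < Nat.gcd n ((q - 1) / r) := Nat.gcd_pos_of_pos_left _ hn
  have hdvd := Nat.gcd_dvd_left n ((q - 1) / r)
  have hd : 0 < n / Nat.gcd n ((q - 1) / r) :=
    Nat.div_pos (Nat.le_of_dvd hn hdvd) hg
  rw [numCosets, leaders_one_eq hq hr0 hn hr, card_filter_Z hr0, card_filter_dvd hd hx2,
    Nat.mod_eq_zero_of_dvd (Nat.div_dvd_of_dvd hdvd), if_neg (Nat.not_lt_zero _),
    Nat.div_div_self hdvd hn.ne', add_zero]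

/-- Singleton indices form one residue class modulo `d`, and `e` belongs to it, so exactly `e / d`
of them precede `e`. -/
theorem mem_firstElems_leaders_one {e a : ℕ} (hq : 1 ≤ q) (hr0 : 0 < r) (hn : 0 < n)
    (hr : r ∣ q - 1) (he : 1 + e * r ∈ leaders q n r 1)
    (ha : e / (n / Nat.gcd n ((q - 1) / r)) < a) :
    1 + e * r ∈ firstElems (leaders q n r 1) a := by
  refine Finset.mem_filter.2 ⟨he, lt_of_eq_of_lt ?_ ha⟩
  obtain ⟨hx1, hx2⟩ := (mem_leaders_one_iff hq hr0 hn hr).1 he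
  have hen : e < n := by
    obtain ⟨e', he', h⟩ := mem_Z.1 hx1
    have : e' = e := by simpa [hr0.ne'] using h
    omega
  have hd : 0 < n / Nat.gcd n ((q - 1) / r) :=
    Nat.div_pos (Nat.le_of_dvd hn (Nat.gcd_dvd_left _ _)) (Nat.gcd_pos_of_pos_left _ hn)
  have := card_filter_dvd (b := e) hd hx2
  rw [if_neg (lt_irrefl _), add_zero] at this
  rw [← this, leaders_one_eq hq hr0 hn hr, Finset.filter_filter, card_filter_Z hr0]
  congr 1
  ext e'
  simp only [Finset.mem_filter, Finset.mem_range, add_lt_add_iff_left,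
    Nat.mul_lt_mul_right hr0]
  constructor
  · rintro ⟨-, h1, h2⟩
    exact ⟨h2, h1⟩
  · rintro ⟨h1, h2⟩
    exact ⟨h1.trans hen, h2, h1⟩

end Cosets

/-! ### Arithmetic of the triples `(i, j, t)` -/

section Triples

variable {q n r s m k : ℕ}

theorem le_mul_ceilFrac (hq : 2 ≤ q) : (q : ℤ) * k ≤ (q - 1) * ceilFrac q k := by
  have h := Int.le_ceil (((q : ℚ) * k) / ((q : ℚ) - 1))
  have hq' : (0 : ℚ) < (q : ℚ) - 1 := by
    have : (2 : ℚ) ≤ q := by exact_mod_cast hq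
    linarith
  rw [div_le_iff₀ hq'] at h
  have : ((q : ℤ) : ℚ) * (k : ℤ) ≤ ((q : ℤ) - 1) * (ceilFrac q k : ℤ) := by
    rw [ceilFrac]; push_cast; linarith
  exact_mod_cast this

theorem mul_ceilFrac_sub_one_lt (hq : 2 ≤ q) : ((q : ℤ) - 1) * (ceilFrac q k - 1) < q * k := by
  have h := Int.ceil_lt_add_one (((q : ℚ) * k) / ((q : ℚ) - 1))
  have hq' : (0 : ℚ) < (q : ℚ) - 1 := by
    have : (2 : ℚ) ≤ q := by exact_mod_cast hq
    linarith
  rw [← sub_lt_iff_lt_add, lt_div_iff₀ hq'] at h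
  have : ((q : ℤ) - 1 : ℚ) * ((ceilFrac q k : ℤ) - 1) < (q : ℤ) * (k : ℤ) := by
    rw [ceilFrac]; push_cast; linarith
  exact_mod_cast this

theorem ceilFrac_zero : ceilFrac q 0 = 0 := by
  simp [ceilFrac]

/-- Clearing the denominator in the bound on `t` gives the inequality between `x = q^i + q * t + j`
and its conjugate. Positivity of the logarithm gives `i < m`, which makes the denominator positive.
-/
theorem tripleSet_spec {i j t : ℕ} (hq : 2 ≤ q) (hs : 1 ≤ s) (h : (i, j, t) ∈ tripleSet q r s m k) :
    m + 1 ≤ 2 * i ∧ i < m ∧ 1 ≤ j ∧ j < q ∧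
      (q * t + j) * q ^ (m - i) + 1 < q ^ i + (q * t + j) ∧
      q ^ i + q * t + j ≡ 1 [MOD r] ∧
      ((q ^ i + q * t + j : ℕ) : ℤ) ≤ 1 + (ceilFrac q k - 2) * r := by
  obtain ⟨h1, h2, h3, h4, h5, h6, h7⟩ := h
  have hq' : (2 : ℝ) ≤ q := by exact_mod_cast hq
  have hs' : (1 : ℝ) ≤ s := by exact_mod_cast hs
  have him : i < m := by
    have hlog : 0 < Real.logb q ((s : ℝ) + 1) := Real.logb_pos (by linarith) (by linarith)
    have : (i : ℝ) ≤ m - Real.logb q ((s : ℝ) + 1) := by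
      have := Int.le_floor.1 h2
      exact_mod_cast this
    have : (i : ℝ) < m := by linarith
    exact_mod_cast this
  refine ⟨?_, him, h3, by omega, ?_, h6, h7⟩
  · have : (m : ℝ) + 1 ≤ 2 * i := by linarith
    exact_mod_cast this
  · have hp : (q : ℝ) ≤ (q : ℝ) ^ (m - i) := le_self_pow₀ (by linarith) (by omega)
    have hpos : 0 < (q : ℝ) ^ (m - i + 1) - q := by
      rw [pow_succ]; nlinarith
    rw [lt_div_iff₀ hpos, pow_succ] at h5
    have : ((q : ℝ) * t + j) * (q : ℝ) ^ (m - i) + 1 < (q : ℝ) ^ i + (q * t + j) := by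
      nlinarith
    exact_mod_cast this

theorem lt_pow_of_mul_pow_lt {i y : ℕ} (hq : 2 ≤ q) (him : i < m)
    (h : y * q ^ (m - i) + 1 < q ^ i + y) : y < q ^ i := by
  have : 2 ≤ q ^ (m - i) := hq.trans (Nat.le_self_pow (by omega) q)
  nlinarith

/-- Since `q * t + j < q^i`, the value determines `i` as its base-`q` logarithm; then `j` and `t`
are remainder and quotient by `q`. -/
theorem tripleSet_injOn (hq : 2 ≤ q) (hs : 1 ≤ s) :
    Set.InjOn (fun p : ℕ × ℕ × ℕ => q ^ p.1 + q * p.2.2 + p.2.1) (tripleSet q r s m k) := by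
  have hlog : ∀ i y : ℕ, y < q ^ i → Nat.log q (q ^ i + y) = i := fun i y hy => by
    refine Nat.log_eq_of_pow_le_of_lt_pow (by omega) ?_
    rw [pow_succ]; nlinarith
  rintro ⟨i, j, t⟩ h ⟨i', j', t'⟩ h' heq
  obtain ⟨-, a1, a2, a3, a4, -⟩ := tripleSet_spec hq hs h
  obtain ⟨-, b1, b2, b3, b4, -⟩ := tripleSet_spec hq hs h'
  simp only [add_assoc] at heq
  have e1 := hlog _ _ (lt_pow_of_mul_pow_lt hq a1 a4)
  have e2 := hlog _ _ (lt_pow_of_mul_pow_lt hq b1 b4)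
  rw [heq, e2] at e1
  subst e1
  have hy := Nat.add_left_cancel heq
  have hj : (q * t + j) % q = (q * t' + j') % q := by rw [hy]
  rw [Nat.mul_add_mod, Nat.mul_add_mod, Nat.mod_eq_of_lt a3, Nat.mod_eq_of_lt b3] at hj
  subst hj
  have : t = t' := Nat.eq_of_mul_eq_mul_left (by omega) (Nat.add_right_cancel hy)
  rw [this]

theorem not_leader_of_lt {i y N : ℕ} (him : i ≤ m) (hq : q ^ m ≡ 1 [MOD N])
    (hN : q ^ i + y ≤ N) (h : y * q ^ (m - i) + 1 < q ^ i + y) :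
    ∃ z ∈ coset q N (q ^ i + y), z < q ^ i + y := by
  refine ⟨y * q ^ (m - i) + 1, mem_coset.2 ⟨⟨by omega, by omega⟩, m - i, ?_⟩, h⟩
  rw [add_mul, ← pow_add, Nat.add_sub_cancel' him, add_comm]
  exact hq.symm.add_right _

end Triples

/-! ### Counting leaders among the first indices of `Z` -/

section Counting

variable {q n r s m k : ℕ}

theorem not_dvd_of_mem_leaders {l x : ℕ} (hr0 : 0 < r) (hq2 : 2 ≤ q) (hm : 1 ≤ m)
    (hq : q ^ m ≡ 1 [MOD n * r]) (hx : x ∈ leaders q n r l) : ¬ q ∣ x := by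
  rintro ⟨c, rfl⟩
  obtain ⟨hZ, hmin, -⟩ := mem_leaders.1 hx
  obtain ⟨h1, h2⟩ := bounds_of_mem_Z hr0 hZ
  have hc : 1 ≤ c := Nat.pos_of_ne_zero (by rintro rfl; simp at h1)
  have hlt : c < q * c := by nlinarith
  have := hmin c (mem_coset.2 ⟨⟨hc, by omega⟩, m - 1, ?_⟩)
  · omega
  · have e : q * c * q ^ (m - 1) = c * q ^ m := by
      obtain ⟨d, rfl⟩ := Nat.exists_eq_add_of_le hm
      rw [Nat.add_sub_cancel_left]; ring
    rw [e]
    simpa using (hq.mul_left c).symm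

theorem tripleSet_finite (hq : 2 ≤ q) (hs : 1 ≤ s) : (tripleSet q r s m k).Finite := by
  refine Set.Finite.of_injOn (t := Set.Iic (1 + (ceilFrac q k - 2) * r).toNat) ?_
    (tripleSet_injOn hq hs) (Set.finite_Iic _)
  rintro ⟨i, j, t⟩ h
  have := (tripleSet_spec hq hs h).2.2.2.2.2.2
  simp only [Set.mem_Iic]
  omega

/-- Triples, multiples of `q`, and a set `P` of other indices all fit into the first `M`
indices of `Z`. -/
theorem card_add_ncard_tripleSet_le {M : ℕ} (hq : 2 ≤ q) (hs : 1 ≤ s)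
    (hr : r ∣ q - 1) (hM : ∀ i j t, (i, j, t) ∈ tripleSet q r s m k → q ^ i + q * t + j < 1 + M * r)
    (P : Finset ℕ) (hPM : ∀ e ∈ P, e < M) (hPq : ∀ e ∈ P, ¬ q ∣ 1 + e * r)
    (hPS : ∀ e ∈ P, ∀ i j t, (i, j, t) ∈ tripleSet q r s m k → q ^ i + q * t + j ≠ 1 + e * r) :
    P.card + (tripleSet q r s m k).ncard + M / q ≤ M := by
  classical
  set D := (Finset.range M).filter fun e => q ∣ 1 + e * r with hD
  have hDcard : M / q ≤ D.card := by
    have h₀ : q ∣ 1 + (q - 1) / r * r := by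
      rw [Nat.div_mul_cancel hr, Nat.add_sub_cancel' (by omega)]
    rw [hD, card_filter_dvd (by omega) h₀]
    exact Nat.le_add_right _ _
  have hdisj : Disjoint D P := by
    rw [Finset.disjoint_left]
    intro e he heP
    exact hPq e heP (Finset.mem_filter.1 he).2
  have hsub : D ∪ P ⊆ Finset.range M := by
    intro e he
    rcases Finset.mem_union.1 he with h | h
    · exact (Finset.mem_filter.1 h).1
    · exact Finset.mem_range.2 (hPM e h)
  have hS : (tripleSet q r s m k).ncard ≤ (Finset.range M \ (D ∪ P)).card := by
    rw [← Set.ncard_coe_finset]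
    have hidx : ∀ i j t, (i, j, t) ∈ tripleSet q r s m k →
        q ^ i + q * t + j = 1 + (q ^ i + q * t + j - 1) / r * r := by
      intro i j t h
      obtain ⟨-, -, h3, -, -, h6, -⟩ := tripleSet_spec hq hs h
      rw [Nat.div_mul_cancel ((Nat.modEq_iff_dvd' (by omega)).1 h6.symm)]
      omega
    refine Set.ncard_le_ncard_of_injOn
      (fun p : ℕ × ℕ × ℕ => (q ^ p.1 + q * p.2.2 + p.2.1 - 1) / r) ?_ ?_ (Finset.finite_toSet _)
    · rintro ⟨i, j, t⟩ h
      have he := hidx i j t h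
      have hlt := hM i j t h
      obtain ⟨-, -, h3, h4, -⟩ := tripleSet_spec hq hs h
      have hi : i ≠ 0 := by have := (tripleSet_spec hq hs h).1; omega
      simp only [Finset.coe_sdiff, Set.mem_sdiff, Finset.mem_coe, Finset.mem_range,
        Finset.mem_union, not_or]
      set e := (q ^ i + q * t + j - 1) / r
      refine ⟨?_, fun heD => ?_, fun heP => hPS e heP i j t h he⟩
      · rw [he] at hlt
        exact lt_of_mul_lt_mul_right (Nat.lt_of_add_lt_add_left hlt) (Nat.zero_le r)
      · have hdvd := (Finset.mem_filter.1 heD).2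
        rw [← he] at hdvd
        have h5 : q ∣ q ^ i + q * t := dvd_add (dvd_pow_self q hi) (dvd_mul_right _ _)
        have h6 := (Nat.dvd_add_right h5).1 hdvd
        exact absurd (Nat.le_of_dvd (by omega) h6) (by omega)
    · rintro ⟨i, j, t⟩ h ⟨i', j', t'⟩ h' heq
      refine tripleSet_injOn hq hs h h' ?_
      simp only at heq ⊢
      rw [hidx i j t h, hidx i' j' t' h', heq]
  rw [Finset.card_sdiff_of_subset hsub, Finset.card_union_of_disjoint hdisj,
    Finset.card_range] at hS
  have := Finset.card_le_card hsub
  rw [Finset.card_union_of_disjoint hdisj, Finset.card_range] at this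
  omega

/-- Turns the ceiling estimates into a bound on how many of `M` indices survive discarding the
multiples of `q`. -/
theorem sub_div_le {M c : ℕ} (hq : 2 ≤ q) (h : ((q : ℤ) - 1) * M ≤ q * c - 1) :
    M - M / q ≤ c := by
  have h1 := Nat.div_add_mod M q
  have h2 := Nat.mod_lt M (show 0 < q by omega)
  set d := M / q
  set ρ := M % q
  have h3 : (M : ℤ) = q * d + ρ := by exact_mod_cast h1.symm
  rw [h3] at h
  have h2' : (ρ : ℤ) + 1 ≤ q := by exact_mod_cast h2
  have h4 : ((q : ℤ) - 1) * d + ρ < c + 1 := by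
    by_contra hc
    push Not at hc
    nlinarith
  zify [Nat.div_le_self M q, show d ≤ M from Nat.div_le_self M q]
  rw [h3]
  linarith

theorem two_le_ceilFrac (hq : 2 ≤ q) (hk : 1 ≤ k) : 2 ≤ ceilFrac q k := by
  have := le_mul_ceilFrac (k := k) hq
  by_contra hc
  push Not at hc
  have h2 : (0 : ℤ) < (q : ℤ) - 1 := by omega
  have h3 : (1 : ℤ) ≤ k := by exact_mod_cast hk
  nlinarith

/-- The element `1` (index `0`) is neither a multiple of `q` nor the value of a triple, so it takes
one of the at most `k` remaining places. -/
theorem ncard_tripleSet_lt (hq : 2 ≤ q) (hs : 1 ≤ s) (hr0 : 0 < r) (hr : r ∣ q - 1)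
    (hk : 1 ≤ k) : (tripleSet q r s m k).ncard + 1 ≤ k := by
  have hA := two_le_ceilFrac hq hk
  have hlt := mul_ceilFrac_sub_one_lt (k := k) hq
  obtain ⟨M, hM⟩ : ∃ M : ℕ, ceilFrac q k = M + 1 := ⟨(ceilFrac q k - 1).toNat, by omega⟩
  rw [hM] at hlt
  have hbound := card_add_ncard_tripleSet_le (M := M) (m := m) (k := k) hq hs hr ?_ {0}
    ?_ ?_ ?_
  · have := sub_div_le (M := M) (c := k) hq (by
      rw [add_sub_cancel_right] at hlt; omega)
    rw [Finset.card_singleton] at hbound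
    omega
  · intro i j t h
    have h7 := (tripleSet_spec hq hs h).2.2.2.2.2.2
    rw [hM] at h7
    have hr1 : (1 : ℤ) ≤ r := by exact_mod_cast hr0
    have : ((q ^ i + q * t + j : ℕ) : ℤ) < ((1 + M * r : ℕ) : ℤ) := by
      push_cast at h7 ⊢
      nlinarith
    exact_mod_cast this
  · simp; omega
  · simp; omega
  · intro e he i j t h
    obtain ⟨-, -, h3, -⟩ := tripleSet_spec hq hs h
    have : 0 < q ^ i := by positivity
    rw [Finset.mem_singleton.1 he]
    omega

theorem tripleSet_eq_empty_of_two (hq : 2 ≤ q) (hs : 1 ≤ s) : tripleSet q r s 2 k = ∅ := by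
  refine Set.eq_empty_of_forall_notMem ?_
  rintro ⟨i, j, t⟩ h
  have := tripleSet_spec hq hs h
  omega

theorem tripleSet_eq_empty_of_ceilFrac_le (hq : 2 ≤ q) (hs : 1 ≤ s) (h2 : ceilFrac q k ≤ 2) :
    tripleSet q r s m k = ∅ := by
  refine Set.eq_empty_of_forall_notMem ?_
  rintro ⟨i, j, t⟩ h
  obtain ⟨-, -, h3, -, -, -, h7⟩ := tripleSet_spec hq hs h
  have : 0 < q ^ i := by positivity
  have h4 : (ceilFrac q k - 2) * (r : ℤ) ≤ 0 :=
    mul_nonpos_of_nonpos_of_nonneg (by omega) (by omega)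
  omega

/-- The indices governed by the bound lie in the first half of `Z`. -/
theorem two_mul_distBound_lt {N : ℕ} (hq : 2 ≤ q) (hr0 : 0 < r) (hs : 1 ≤ s) (hr : r ∣ q - 1)
    (hm : 1 < m) (hnrs : n * r * s = q ^ m - 1) (hk : 1 ≤ k) (hkN : 2 * k ≤ N + 1)
    (hN : 1 + m * N ≤ n) : 2 * (distBound q r s m k - 2) + 1 < n := by
  have hA := two_le_ceilFrac hq hk
  have hAlt := mul_ceilFrac_sub_one_lt (k := k) hq
  have hSk := ncard_tripleSet_lt (m := m) hq hs hr0 hr hk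
  have hq2 : (2 : ℤ) ≤ q := by exact_mod_cast hq
  have hk' : (1 : ℤ) ≤ k := by exact_mod_cast hk
  have hA2 : ceilFrac q k ≤ 2 * k := by
    by_contra hc
    push Not at hc
    nlinarith
  by_cases hempty : tripleSet q r s m k = ∅
  · have hn : 4 * k ≤ n + 1 := by nlinarith
    rw [distBound, hempty, Set.ncard_empty, ceilFrac_zero]
    omega
  · have hm2 : m ≠ 2 := by
      rintro rfl
      exact hempty (tripleSet_eq_empty_of_two hq hs)
    set A := ceilFrac q k
    set c := (tripleSet q r s m k).ncard
    have hB := mul_ceilFrac_sub_one_lt (k := c) hq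
    -- Lowering `k` by one lowers `q * k / (q - 1)` by more than one.
    have hBA : ceilFrac q c ≤ A - 1 := by
      have hA1 := le_mul_ceilFrac (k := k) hq
      have hck : (c : ℤ) + 1 ≤ k := by exact_mod_cast hSk
      by_contra hc
      push Not at hc
      have h1 : A ≤ ceilFrac q c := by omega
      nlinarith
    have hdb : distBound q r s m k = A + (ceilFrac q c - 1) := rfl
    rcases Nat.lt_or_ge q 3 with hq3 | hq3
    · obtain rfl : q = 2 := by omega
      -- For `q = 2`, `m = 3` the length divides `7`, so `k ≤ 1` and there is no room for a triple.
      have hm3 : m ≠ 3 := by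
        rintro rfl
        apply hempty
        apply tripleSet_eq_empty_of_ceilFrac_le hq hs
        have : n ≤ 7 := by
          have h7 : n * (r * s) = 7 := by rw [← mul_assoc, hnrs]; norm_num
          exact Nat.le_of_dvd (by norm_num) ⟨_, h7.symm⟩
        omega
      have hn : 8 * k ≤ n + 3 := by
        have : 4 * N ≤ m * N := Nat.mul_le_mul_right _ (by omega)
        omega
      omega
    · have hn : 6 * k ≤ n + 2 := by
        have : 3 * N ≤ m * N := Nat.mul_le_mul_right _ (by omega)
        omega
      have hA3 : 2 * A ≤ 3 * k + 1 := by
        have hq3' : (3 : ℤ) ≤ q := by exact_mod_cast hq3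
        by_contra hc
        push Not at hc
        nlinarith
      omega

theorem mem_firstElems_leaders {l e : ℕ} (hq2 : 2 ≤ q) (hr0 : 0 < r) (hs : 1 ≤ s)
    (hr : r ∣ q - 1) (hm : 1 ≤ m) (hq : q ^ m ≡ 1 [MOD n * r])
    (he : (e : ℤ) ≤ distBound q r s m k - 2) (hn : distBound q r s m k - 2 < n)
    (hx : 1 + e * r ∈ leaders q n r l) : 1 + e * r ∈ firstElems (leaders q n r l) k := by
  classical
  refine Finset.mem_filter.2 ⟨hx, ?_⟩
  set A := ceilFrac q k with hA
  set c := (tripleSet q r s m k).ncard with hc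
  have hfin : (tripleSet q r s m k).Finite := tripleSet_finite hq2 hs
  have hAlt := mul_ceilFrac_sub_one_lt (k := k) hq2
  have hBlt := mul_ceilFrac_sub_one_lt (k := c) hq2
  have hdb : distBound q r s m k = A + (ceilFrac q c - 1) := rfl
  rw [hdb] at he hn
  -- `M` is `distBound - 1`, the number of consecutive zeros that the BCH bound requires.
  obtain ⟨M, hM⟩ : ∃ M : ℕ, A + ceilFrac q c - 2 = M := ⟨(A + ceilFrac q c - 2).toNat, by omega⟩
  have hMn : M ≤ n := by omega
  have heM : e < M := by omega
  have hr1 : (1 : ℤ) ≤ r := by exact_mod_cast hr0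
  have hval : ∀ i j t, (i, j, t) ∈ tripleSet q r s m k → q ^ i + q * t + j < 1 + M * r := by
    intro i j t h
    have h7 := (tripleSet_spec hq2 hs h).2.2.2.2.2.2
    have hc1 : 1 ≤ c := (Set.ncard_pos hfin).2 ⟨_, h⟩
    have hB := two_le_ceilFrac hq2 hc1
    have : ((q ^ i + q * t + j : ℕ) : ℤ) < ((1 + M * r : ℕ) : ℤ) := by
      refine h7.trans_lt ?_
      push_cast
      have : (A - 2) * (r : ℤ) < M * r := mul_lt_mul_of_pos_right (by omega) (by omega)
      linarith
    exact_mod_cast this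
  set P := (Finset.range M).filter fun e' => 1 + e' * r ∈ leaders q n r l with hP
  have hbound := card_add_ncard_tripleSet_le (M := M) (m := m) (k := k) hq2 hs hr hval P
    (fun e' h => Finset.mem_range.1 (Finset.mem_filter.1 h).1)
    (fun e' h => not_dvd_of_mem_leaders hr0 hq2 hm hq (Finset.mem_filter.1 h).2) (by
      intro e' he' i j t h heq
      obtain ⟨-, h2, -, -, h5, -⟩ := tripleSet_spec hq2 hs h
      obtain ⟨hZ, hmin, -⟩ := mem_leaders.1 (Finset.mem_filter.1 he').2
      rw [← heq, add_assoc] at hZ hmin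
      obtain ⟨z, hz, hlt⟩ := not_leader_of_lt h2.le hq (bounds_of_mem_Z hr0 hZ).2 h5
      exact absurd (hmin z hz) (by omega))
  -- Adding the strict ceiling inequalities for `k` and `c` gives `(q - 1) * M < q * (k + c)`.
  have hMk : M - M / q ≤ k + c := by
    apply sub_div_le hq2
    rcases Nat.eq_zero_or_pos c with h0 | hpos
    · rw [h0, ceilFrac_zero] at hM
      have : (M : ℤ) = A - 2 := by omega
      rw [this, h0]
      push_cast
      nlinarith
    · rw [← hM]
      push_cast
      nlinarith
  have hPk : P.card ≤ k := by omega
  -- The inequality is strict because `1 + e * r` is itself counted by `P` but does not precede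
  -- itself.
  refine lt_of_lt_of_le ?_ hPk
  rw [← Finset.card_image_of_injective P (f := fun e' => 1 + e' * r)
    (fun a b h => by simpa [hr0.ne'] using h)]
  refine Finset.card_lt_card (Finset.ssubset_iff_of_subset ?_ |>.2 ⟨1 + e * r, ?_, ?_⟩)
  · intro y hy
    obtain ⟨hy1, hy2⟩ := Finset.mem_filter.1 hy
    obtain ⟨e', -, rfl⟩ := mem_Z.1 (mem_leaders.1 hy1).1
    have : e' < e := lt_of_mul_lt_mul_right (Nat.lt_of_add_lt_add_left hy2) (Nat.zero_le r)
    exact Finset.mem_image.2 ⟨e', Finset.mem_filter.2 ⟨Finset.mem_range.2 (by omega), hy1⟩, rfl⟩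
  · exact Finset.mem_image.2 ⟨e, Finset.mem_filter.2 ⟨Finset.mem_range.2 heM, hx⟩, rfl⟩
  · simp

end Counting

/-! ### Zeros of the generator and the BCH bound -/

section Codes

variable {F K : Type*} [Field F] [Field K] [Algebra F K] {n r : ℕ} {β : K} {lam : F}

/-- Evaluations of codewords at the constacyclic zeros of the generator vanish. -/
theorem sum_eq_zero_of_mem_constacyclicCode {g : F[X]} {x : K} (hx : x ^ n = algebraMap F K lam)
    (hg : aeval x g = 0) {c : Fin n → F} (hc : c ∈ constacyclicCode n lam g) :
    ∑ i, algebraMap F K (c i) * x ^ (i : ℕ) = 0 := by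
  have hc' : (Fintype.linearCombination F fun i : Fin n =>
      AdjoinRoot.root (X ^ n - C lam) ^ (i : ℕ)) c ∈
        Ideal.span {AdjoinRoot.mk (X ^ n - C lam) g} := hc
  rw [Ideal.mem_span_singleton] at hc'
  obtain ⟨h', hh⟩ := hc'
  obtain ⟨h, rfl⟩ := AdjoinRoot.mk_surjective h'
  have hp : (Fintype.linearCombination F fun i : Fin n =>
      AdjoinRoot.root (X ^ n - C lam) ^ (i : ℕ)) c =
        AdjoinRoot.mk (X ^ n - C lam) (∑ i, C (c i) * X ^ (i : ℕ)) := by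
    simp [Fintype.linearCombination_apply, Algebra.smul_def, AdjoinRoot.algebraMap_eq]
  rw [hp, ← map_mul, AdjoinRoot.mk_eq_mk] at hh
  obtain ⟨u, hu⟩ := hh
  have := congrArg (aeval x) hu
  simpa [hg, hx, sub_eq_zero] using this

/-- The BCH bound for constacyclic codes. -/
theorem le_minDist_of_aeval_eq_zero (hr0 : 0 < r) (hβ : IsPrimitiveRoot β (n * r))
    (hlam : algebraMap F K lam = β ^ n) (g : F[X]) (δ : ℕ)
    (h : ∀ e, e + 2 ≤ δ → aeval (β ^ (1 + e * r)) g = 0) :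
    (δ : ℕ∞) ≤ minDist (constacyclicCode n lam g) := by
  classical
  rw [minDist]
  refine le_iInf₂ fun x hx => le_iInf₂ fun y hy => le_iInf fun hxy => ?_
  have hc := Submodule.sub_mem _ hx hy
  have hc0 : x - y ≠ 0 := sub_ne_zero.2 hxy
  rw [hammingDist_comm, hammingDist_eq_hammingNorm, neg_add_eq_sub]
  set c := x - y
  by_contra hlt
  have hlt : hammingNorm c < δ := by exact_mod_cast not_le.1 hlt
  set s := Finset.univ.filter fun i => c i ≠ 0 with hs
  have hw : s.card = hammingNorm c := rfl
  let φ := s.equivFin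
  have hβr : IsPrimitiveRoot (β ^ r) n := by
    rcases Nat.eq_zero_or_pos n with rfl | hn
    · obtain ⟨i, -⟩ := Function.ne_iff.1 hc0
      exact i.elim0
    · exact hβ.pow (Nat.mul_pos hn hr0) (mul_comm n r)
  have hf : Function.Injective fun a : Fin s.card => (β ^ r) ^ ((φ.symm a : Fin n) : ℕ) := by
    intro a b hab
    exact φ.symm.injective (Subtype.ext (Fin.ext
      (hβr.pow_inj (φ.symm a : Fin n).2 (φ.symm b : Fin n).2 hab)))
  -- Vandermonde on the support: the nodes `β^(r * i)` are distinct, the unknowns are `c_i * β^i`,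
  -- and since the weight is below `δ` there are enough zeros for a square system.
  have hv := Matrix.eq_zero_of_forall_pow_sum_mul_pow_eq_zero (f := fun a : Fin s.card =>
    (β ^ r) ^ ((φ.symm a : Fin n) : ℕ)) (v := fun a : Fin s.card =>
    algebraMap F K (c (φ.symm a)) * β ^ ((φ.symm a : Fin n) : ℕ)) hf (by
      intro e
      have hx : (β ^ (1 + (e : ℕ) * r)) ^ n = algebraMap F K lam := by
        rw [← pow_mul, add_mul, one_mul, pow_add, hlam,
          show (e : ℕ) * r * n = n * r * e by ring, pow_mul, hβ.pow_eq_one, one_pow, mul_one]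
      have hsum := sum_eq_zero_of_mem_constacyclicCode hx (h e (by have := e.2; omega)) hc
      rw [← hsum, ← Finset.sum_subset (Finset.subset_univ s) (fun i _ hi => by
        have : c i = 0 := by simpa [hs] using hi
        simp [this]), ← Finset.sum_coe_sort s, ← Equiv.sum_comp φ.symm]
      refine Finset.sum_congr rfl fun a _ => ?_
      simp only [c]
      ring)
  obtain ⟨i, hi⟩ := Function.ne_iff.1 hc0
  have his : i ∈ s := by simpa [hs] using hi
  have h0 := congrFun hv (φ ⟨i, his⟩)
  have hβ0 : β ≠ 0 := by
    rintro rfl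
    exact (hβ.isUnit (Nat.mul_pos (Fin.pos i) hr0).ne').ne_zero rfl
  simp only [Equiv.symm_apply_apply, Pi.zero_apply, mul_eq_zero, pow_eq_zero_iff', hβ0,
    false_and, or_false, map_eq_zero] at h0
  exact hi h0

/-- `β^x` is the image of `β^i` under the `k`-th power of Frobenius, which fixes `F`. -/
theorem aeval_minpoly_eq_zero_of_modEq [Fintype F] {N i x k : ℕ} (hβ : IsPrimitiveRoot β N)
    (h : x ≡ i * Fintype.card F ^ k [MOD N]) : aeval (β ^ x) (minpoly F (β ^ i)) = 0 := by
  have hpow : β ^ x = ((FiniteField.frobeniusAlgHom F K) ^ k) (β ^ i) := by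
    have hpow' : β ^ x = β ^ (i * Fintype.card F ^ k) := by
      rw [hβ.eq_orderOf, Nat.ModEq] at h
      rw [← pow_mod_orderOf, h, pow_mod_orderOf]
    rw [hpow', pow_mul, AlgHom.coe_pow, FiniteField.coe_frobeniusAlgHom,
      pow_iterate]
  rw [hpow, aeval_algHom_apply, minpoly.aeval, map_zero]

theorem aeval_genPoly_eq_zero {q m a b x y l : ℕ} (h : aeval (β ^ x) (minpoly F (β ^ y)) = 0)
    (hy : y ∈ firstElems (leaders q n r l) a ∨ y ∈ firstElems (leaders q n r m) b) :
    aeval (β ^ x) (genPoly F β q n r l m a b) = 0 := by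
  rw [genPoly, map_mul, map_prod, map_prod]
  rcases hy with hy | hy
  · rw [Finset.prod_eq_zero hy h, zero_mul]
  · rw [Finset.prod_eq_zero hy h, mul_zero]

/-- If the indices below the bound lie in the first half of `Z` and the first `a` cosets of size
`1` cover those of the first half, then the bound holds. -/
theorem distBound_le_minDist [Fintype F] {q m s a k : ℕ} (hcard : Fintype.card F = q)
    (hr0 : 0 < r) (hn0 : 0 < n) (hs : 1 ≤ s) (hr : r ∣ q - 1) (hm : 1 < m)
    (hβ : IsPrimitiveRoot β (n * r)) (hlam : algebraMap F K lam = β ^ n)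
    (hnrs : n * r * s = q ^ m - 1)
    (hsizes : (Z n r).image (fun i => (coset q (n * r) i).card) = {1, m})
    (hqr : q ≡ 1 [MOD r]) (hq : q ^ m ≡ 1 [MOD n * r])
    (hN1 : 1 ≤ numCosets q n r 1) (hkN : 2 * k ≤ numCosets q n r m + 1)
    (ha : ∀ e, 2 * e + 1 < n → n / Nat.gcd n ((q - 1) / r) ∣ 1 + e * r →
      e / (n / Nat.gcd n ((q - 1) / r)) < a) :
    ((distBound q r s m k).toNat : ℕ∞) ≤
      minDist (constacyclicCode n lam (genPoly F β q n r 1 m a k)) := by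
  have hq2 : 2 ≤ q := by rw [← hcard]; exact Fintype.one_lt_card
  -- For `k = 0` the bound is `-1`, which `toNat` turns into the trivial bound `0`.
  rcases Nat.eq_zero_or_pos k with rfl | hk
  · have h0 : distBound q r s m 0 = -1 := by
      rw [distBound, tripleSet_eq_empty_of_ceilFrac_le hq2 hs (by rw [ceilFrac_zero]; norm_num),
        Set.ncard_empty, ceilFrac_zero]
      norm_num
    simp [h0]
  have hsum := numCosets_one_add hr0 hqr hm hq hsizes
  have hhalf := two_mul_distBound_lt (N := numCosets q n r m) hq2 hr0 hs hr hm hnrs hk hkN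
    (by omega)
  refine le_minDist_of_aeval_eq_zero hr0 hβ hlam _ _ fun e he => ?_
  have he' : (e : ℤ) ≤ distBound q r s m k - 2 := by omega
  have hZ : 1 + e * r ∈ Z n r := mem_Z.2 ⟨e, by omega, rfl⟩
  obtain ⟨y, hy, hyx, hxy⟩ := exists_leader hr0 hqr hm.le hq hZ
  obtain ⟨-, j, hj⟩ := mem_coset.1 hxy
  rw [← hcard] at hj
  refine aeval_genPoly_eq_zero (aeval_minpoly_eq_zero_of_modEq hβ hj) ?_
  obtain ⟨e', -, rfl⟩ := mem_Z.1 (mem_leaders.1 hy).1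
  have hee : e' ≤ e := le_of_mul_le_mul_right (Nat.le_of_add_le_add_left hyx) hr0
  rcases card_coset_mem hsizes hZ with h | h <;> rw [h] at hy
  · exact Or.inl (mem_firstElems_leaders_one (by omega) hr0 hn0 hr hy
      (ha e' (by omega) ((mem_leaders_one_iff (by omega) hr0 hn0 hr).1 hy).2))
  · exact Or.inr (mem_firstElems_leaders hq2 hr0 hs hr hm.le hq (by omega) (by omega) hy)

end Codes

end Consta

/-! ### The main theorem -/

theorem theorem2 {F K : Type*} [Field F] [Fintype F] [Field K] [Algebra F K]
    (q n r m s : ℕ) (hq : Fintype.card F = q) (hnq : Nat.Coprime n q) (hr : r ∣ q - 1)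
    (β : K) (hβ : IsPrimitiveRoot β (n * r))
    (lam : F) (hlam : algebraMap F K lam = β ^ n)
    (hm : 1 < m) (hs : n * r * s = q ^ m - 1)
    (hsizes : (Consta.Z n r).image (fun i => (Consta.coset q (n * r) i).card) = {1, m}) :
    (Consta.numCosets q n r m : ℚ) = ((n : ℚ) - Nat.gcd n ((q - 1) / r)) / m ∧
    ((Consta.distBound q r s m ⌈(Consta.numCosets q n r m : ℚ) / 2⌉₊).toNat : ℕ∞) ≤
      Consta.minDist (Consta.constacyclicCode n lam
        (Consta.genPoly F β q n r 1 m
          ⌈(Consta.numCosets q n r 1 : ℚ) / 2⌉₊ ⌈(Consta.numCosets q n r m : ℚ) / 2⌉₊)) ∧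
    (r ≤ 2 →
      ((Consta.distBound q r s m ⌊(Consta.numCosets q n r m : ℚ) / 2⌋₊).toNat : ℕ∞) ≤
        Consta.minDist (Consta.constacyclicCode n lam
          (Consta.genPoly F β q n r 1 m
            ⌊(Consta.numCosets q n r 1 : ℚ) / 2⌋₊ ⌊(Consta.numCosets q n r m : ℚ) / 2⌋₊))) := by
  have hq2 : 2 ≤ q := by rw [← hq]; exact Fintype.one_lt_card
  have hqm : 2 ≤ q ^ m := hq2.trans (Nat.le_self_pow (by omega) q)
  have hpos : 0 < n * r * s := by omega
  have hs1 : 1 ≤ s := Nat.pos_of_mul_pos_left hpos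
  have hnr : 0 < n * r := Nat.pos_of_mul_pos_right hpos
  have hr0 : 0 < r := Nat.pos_of_mul_pos_left hnr
  have hn0 : 0 < n := Nat.pos_of_mul_pos_right hnr
  have hqr : q ≡ 1 [MOD r] := ((Nat.modEq_iff_dvd' (by omega)).2 hr).symm
  have hqN : q ^ m ≡ 1 [MOD n * r] := ((Nat.modEq_iff_dvd' (by omega)).2 ⟨s, hs.symm⟩).symm
  have hne : (Consta.leaders q n r 1).Nonempty := by
    have h1 : 1 ∈ (Consta.Z n r).image (fun i => (Consta.coset q (n * r) i).card) := by
      rw [hsizes]; simp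
    obtain ⟨x, hx, hx1⟩ := Finset.mem_image.1 h1
    obtain ⟨y, hy, -⟩ := Consta.exists_leader hr0 hqr hm.le hqN hx
    rw [hx1] at hy
    exact ⟨y, hy⟩
  have hN1 := Consta.numCosets_one (by omega) hr0 hn0 hr hne
  have hN1pos : 1 ≤ Consta.numCosets q n r 1 := Finset.card_pos.2 hne
  have hsum := Consta.numCosets_one_add hr0 hqr hm hqN hsizes
  have hceil : ∀ a : ℕ, ⌈(a : ℚ) / 2⌉₊ = (a + 1) / 2 := fun a => by
    obtain ⟨c, rfl | rfl⟩ := Nat.even_or_odd' a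
    · rw [show (2 * c + 1) / 2 = c by omega]
      simp
    · rw [show (2 * c + 1 + 1) / 2 = c + 1 by omega, Nat.ceil_eq_iff (by omega)]
      rw [Nat.add_sub_cancel]
      push_cast
      constructor <;> linarith
  have hfloor : ∀ a : ℕ, ⌊(a : ℚ) / 2⌋₊ = a / 2 := fun a => by
    simpa using Nat.floor_div_eq_div (K := ℚ) a 2
  have hgd : Nat.gcd n ((q - 1) / r) * (n / Nat.gcd n ((q - 1) / r)) = n :=
    Nat.mul_div_cancel' (Nat.gcd_dvd_left _ _)
  simp only [hceil, hfloor]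
  refine ⟨?_, ?_, fun hr2 => ?_⟩
  · have hm0 : (m : ℚ) ≠ 0 := by positivity
    rw [eq_div_iff hm0, ← hN1]
    have : (n : ℚ) = Consta.numCosets q n r 1 + m * Consta.numCosets q n r m := by
      exact_mod_cast hsum.symm
    rw [this]; ring
  · refine Consta.distBound_le_minDist hq hr0 hn0 hs1 hr hm hβ hlam hs hsizes hqr hqN hN1pos
      (by omega) fun e he _ => ?_
    rw [hN1]
    set g := Nat.gcd n ((q - 1) / r)
    -- With `d = n / g`: `2 * d * (e / d) ≤ 2 * e < n = g * d`.
    have hlt : 2 * (e / (n / g)) < g := by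
      have := Nat.mul_div_le e (n / g)
      by_contra hc
      push Not at hc
      nlinarith [Nat.mul_le_mul_right (n / g) hc]
    omega
  · refine Consta.distBound_le_minDist hq hr0 hn0 hs1 hr hm hβ hlam hs hsizes hqr hqN hN1pos
      (by omega) fun e he hd => ?_
    rw [hN1]
    set g := Nat.gcd n ((q - 1) / r)
    obtain ⟨c, hc⟩ := hd
    set d := n / g
    have hje := Nat.mul_div_le e d
    set j := e / d
    -- Rounding down requires one singleton more in the first half. With `1 + e * r = d * c`: for `r
    -- = 1`, `j < c` and `2 * c ≤ g`; for `r = 2`, `2 * j < c < g`.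
    have hlt : 2 * (j + 1) ≤ g := by
      obtain rfl | rfl : r = 1 ∨ r = 2 := by omega
      · have h1 : j < c := lt_of_mul_lt_mul_left (show d * j < d * c by omega) (Nat.zero_le d)
        have h2 : 2 * c ≤ g := by
          by_contra h
          push Not at h
          have := Nat.mul_le_mul_right d h
          have : 2 * (d * c) ≤ n := by omega
          nlinarith
        omega
      · have h1 : 2 * j < c := by
          refine lt_of_mul_lt_mul_left (show d * (2 * j) < d * c from ?_) (Nat.zero_le d)
          rw [← hc]; nlinarith
        have h2 : c < g := by
          refine lt_of_mul_lt_mul_left (show d * c < d * g from ?_) (Nat.zero_le d)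
          rw [← hc, mul_comm d g, hgd]; omega
        omega
    omega
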